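/- Let $P$ be a self-adjoint operator on a complex Hilbert space $\mathcal H$ and $R(\lambda)=(P-\lambda^2)^{-1}$. For $s\ge 0$ let $\mathcal D^s=(P+i)^{-s}\mathcal H$ with the norm $\|g\|_{\mathcal D^s}=\|(P+i)^sg\|_{\mathcal H}$. Let $\chi:\mathcal H\to\mathcal H$ be bounded, let $c_0>0$ and $p,q\ge 0$, and assume: (a) the family of bounded operators $\chi R(\lambda)\chi$ continues holomorphically from $\{\operatorname{Im}\lambda>0,\ \operatorname{Re}\lambda\neq0\}$ to $\{\operatorname{Im}\lambda>-c_0,\ \operatorname{Re}\lambda\ne0\}$; (b) there are bounded operators $\chi A_{j,k}\chi:\mathcal D^p\to\mathcal D^q$ and numbers $\nu_j\in\mathbb R$, $b_{j,k}\in\mathbb C\setminus i[0,\infty)$ ($j\in\mathbb N$, $k\in\mathbb Z$) with $$\chi R(\lambda)\chi=\sum_{j,k}\chi A_{j,k}\chi\,\lambda^{\nu_j}\log^k(b_{j,k}\lambda),$$ where the series converges absolutely, and uniformly on compact subsets of $\{\arg\lambda\in(-\frac\pi2,\frac{3\pi}2),\ |\operatorname{Re}\lambda|<c_0,\ |\operatorname{Im}\lambda|<c_0\}$,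 in the operator norm of $\mathcal D^p\to\mathcal D^q$, and the identity holds for $\operatorname{Re}\lambda\neq0$. (Here $\log(b\lambda)=\log b+\log\lambda$ with $\arg\lambda\in(-\frac\pi2,\frac{3\pi}2)$, $\arg b\in(-\frac{3\pi}2,\frac\pi2)$.) Let $0<c<c_0$ and, for $\delta>0$, let $\gamma(\delta,c)$ be the contour going from $-\delta-ic$ up to $-\delta$ along a segment, then from $-\delta$ to $\delta$ along the upper half of the circle $|\lambda|=\delta$, then down to $\delta-ic$ along a segment. For $f\in\mathcal D^p$ with $\chi f=f$ and $t\geq 0$, the zero-energy contribution $u_z(t)$ (to the wave $u$ with $(\partial_t^2+P)u=0$, $u|_{t=0}=0$, $\partial_tu|_{t=0}=f$) is defined, after applying $\chi$, by $$\chi u_z(t)=\frac1{2\pi}\sum_{j,k}\chi A_{j,k}\chi f\lim_{\delta\to0^+}\int_{\gamma(\delta,c)}e^{-it\lambda}\lambda^{\nu_j}\log^k(b_{j,k}\lambda)\,d\lambda .$$ Suppose that all $\nu_j$ are integers $\ge-2$ and that there are no terms with $k\neq0$ (that is, $\chi A_{j,k}\chi=0$ for $k\ne0$). Write $\chi A_{m,0}\chi$,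 for $m\in\mathbb Z$, for the coefficient of $\lambda^{m}$ in the expansion, i.e. the sum of the $\chi A_{j,0}\chi$ over all $j$ with $\nu_j=m$ (so $0$ if $m$ is not an exponent). Then these sums converge in the operator norm of $\mathcal D^p\to\mathcal D^q$; for every $t\ge0$ the limits in the series above exist for all terms that are present (those with $\chi A_{j,k}\chi\neq0$), the series converges in $\mathcal D^q$, and $$\chi u_z(t)=-t\,\chi A_{-2,0}\chi f-i\,\chi A_{-1,0}\chi f .$$ -/

import Mathlib

open scoped InnerProductSpace Topology NNReal

namespace WaveExpansion

variable {H : Type*} [NormedAddCommGroup H] [InnerProductSpace ℂ H] [CompleteSpace H]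

/-- `R` is the bounded two-sided inverse `(P - z)⁻¹` of `P - z : P.domain → H`. -/
def IsResolventAt (P : H →ₗ.[ℂ] H) (z : ℂ) (R : H →L[ℂ] H) : Prop :=
  (∀ x : H, ∃ h : R x ∈ P.domain, P ⟨R x, h⟩ - z • R x = x) ∧
    ∀ x : P.domain, R (P x - z • (x : H)) = x

open Classical in
/-- The resolvent `(P - z)⁻¹` at points `z` of the resolvent set (and `0` elsewhere). -/
noncomputable def resolventOf (P : H →ₗ.[ℂ] H) (z : ℂ) : H →L[ℂ] H :=
  if h : ∃ R, IsResolventAt P z R then h.choose else 0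

theorem inner_symm {P : H →ₗ.[ℂ] H} (hP : IsSelfAdjoint P) (x y : P.domain) :
    ⟪P x, (y : H)⟫_ℂ = ⟪(x : H), P y⟫_ℂ := by
  have h := LinearPMap.adjoint_isFormalAdjoint hP.dense_domain
  rw [LinearPMap.isSelfAdjoint_def.mp hP] at h
  exact (h x y)

theorem le_norm_sub_smul {P : H →ₗ.[ℂ] H} (hP : IsSelfAdjoint P) (z : ℂ) (x : P.domain) :
    |z.im| * ‖(x : H)‖ ≤ ‖P x - z • (x : H)‖ := by
  have hreal : (⟪(x : H), P x⟫_ℂ).im = 0 := by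
    have h1 := inner_symm hP x x
    rw [← inner_conj_symm] at h1
    have := congrArg Complex.im h1
    simp only [Complex.conj_im] at this
    linarith
  have him : (⟪(x : H), P x - z • (x : H)⟫_ℂ).im = -(z.im * ‖(x : H)‖ ^ 2) := by
    rw [inner_sub_right, inner_smul_right, inner_self_eq_norm_sq_to_K]
    have : ((‖(x : H)‖ : ℂ) ^ 2) = ((‖(x : H)‖ ^ 2 : ℝ) : ℂ) := by push_cast; rfl
    simp only [Complex.sub_im, hreal, Complex.coe_algebraMap]
    rw [this, Complex.im_mul_ofReal]
    ring
  have h2 : |z.im| * ‖(x : H)‖ ^ 2 ≤ ‖(x : H)‖ * ‖P x - z • (x : H)‖ := by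
    calc |z.im| * ‖(x : H)‖ ^ 2 = |(⟪(x : H), P x - z • (x : H)⟫_ℂ).im| := by
          rw [him, abs_neg, abs_mul, abs_of_nonneg (sq_nonneg ‖(x : H)‖)]
      _ ≤ ‖⟪(x : H), P x - z • (x : H)⟫_ℂ‖ := Complex.abs_im_le_norm _
      _ ≤ _ := norm_inner_le_norm _ _
  rcases eq_or_lt_of_le (norm_nonneg (x : H)) with h0 | h0
  · rw [← h0]; simp
  · nlinarith

theorem exists_isResolventAt {P : H →ₗ.[ℂ] H} (hP : IsSelfAdjoint P) {z : ℂ} (hz : z.im ≠ 0) :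
    ∃ R, IsResolventAt P z R := by
  have hz0 : 0 < |z.im| := abs_pos.mpr hz
  let S : P.domain →ₗ[ℂ] H := P.toFun - z • P.domain.subtype
  have hS : ∀ x, S x = P x - z • (x : H) := fun x => rfl
  have hb : ∀ x : P.domain, |z.im| * ‖(x : H)‖ ≤ ‖S x‖ := fun x => le_norm_sub_smul hP z x
  have hinj : Function.Injective S := by
    rw [← LinearMap.ker_eq_bot, LinearMap.ker_eq_bot']
    intro x hx
    have := hb x
    rw [hx, norm_zero] at this
    have h0 : ‖(x : H)‖ = 0 := by nlinarith [norm_nonneg (x : H)]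
    exact Subtype.ext (norm_eq_zero.mp h0)
  have hclosed : IsClosed (LinearMap.range S : Set H) := by
    rw [← isSeqClosed_iff_isClosed]
    intro y y₀ hy hlim
    choose x hx using hy
    have hc : CauchySeq fun n => (x n : H) := by
      rw [Metric.cauchySeq_iff]
      intro ε hε
      obtain ⟨N, hN⟩ := Metric.cauchySeq_iff.mp hlim.cauchySeq (|z.im| * ε) (by positivity)
      refine ⟨N, fun m hm n hn => ?_⟩
      have h1 := hN m hm n hn
      have h2 := hb (x m - x n)
      rw [map_sub, hx, hx, ← dist_eq_norm, Submodule.coe_sub, ← dist_eq_norm] at h2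
      exact lt_of_mul_lt_mul_left (h2.trans_lt h1) hz0.le
    obtain ⟨x₀, hx₀⟩ := cauchySeq_tendsto_of_complete hc
    have hPx : Filter.Tendsto (fun n => ((x n : H), P (x n))) Filter.atTop
        (𝓝 (x₀, y₀ + z • x₀)) := by
      refine hx₀.prodMk_nhds ((hlim.add (hx₀.const_smul z)).congr fun n => ?_)
      rw [← hx n, hS]; abel
    have hmem : (x₀, y₀ + z • x₀) ∈ P.graph :=
      hP.isClosed.mem_of_tendsto hPx (Filter.Eventually.of_forall fun n => P.mem_graph (x n))
    obtain ⟨w, hw1, hw2⟩ := (LinearPMap.mem_graph_iff P).mp hmem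
    refine ⟨w, ?_⟩
    simp only at hw1 hw2
    rw [hS, hw2, hw1]; abel
  have hperp : (LinearMap.range S)ᗮ = ⊥ := by
    rw [eq_bot_iff]
    intro v hv
    have h1 : ∀ x : P.domain, ⟪(starRingEnd ℂ z) • v, (x : H)⟫_ℂ = ⟪v, P x⟫_ℂ := by
      intro x
      have h2 := (Submodule.mem_orthogonal' _ v).mp hv (S x) ⟨x, rfl⟩
      rw [hS, inner_sub_right, inner_smul_right, sub_eq_zero] at h2
      rw [inner_smul_left, Complex.conj_conj, h2]
    have hd : v ∈ P.adjoint.domain := LinearPMap.mem_adjoint_domain_of_exists v ⟨_, h1⟩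
    have he : P.adjoint ⟨v, hd⟩ = (starRingEnd ℂ z) • v :=
      LinearPMap.adjoint_apply_eq hP.dense_domain ⟨v, hd⟩ h1
    have key : ∀ Q : H →ₗ.[ℂ] H, Q = P → ∀ h : v ∈ Q.domain, Q ⟨v, h⟩ = (starRingEnd ℂ z) • v →
        v = 0 := by
      rintro Q rfl h hv
      have := le_norm_sub_smul hP (starRingEnd ℂ z) ⟨v, h⟩
      rw [hv] at this
      simp only [Complex.conj_im, abs_neg, sub_self, norm_zero] at this
      have h0 : ‖v‖ = 0 := by nlinarith [norm_nonneg v]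
      exact norm_eq_zero.mp h0
    exact key _ (LinearPMap.isSelfAdjoint_def.mp hP) hd he
  have htop : LinearMap.range S = ⊤ := by
    have : CompleteSpace (LinearMap.range S) := hclosed.completeSpace_coe
    exact Submodule.orthogonal_eq_bot_iff.mp hperp
  let e := LinearEquiv.ofBijective S ⟨hinj, LinearMap.range_eq_top.mp htop⟩
  have hee : ∀ y, S (e.symm y) = y := fun y => e.apply_symm_apply y
  let R : H →L[ℂ] H := LinearMap.mkContinuous (P.domain.subtype ∘ₗ e.symm.toLinearMap) |z.im|⁻¹
    (fun y => by
      have := hb (e.symm y)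
      rw [hee] at this
      rw [inv_mul_eq_div, le_div_iff₀ hz0, mul_comm]
      exact this)
  refine ⟨R, fun y => ⟨(e.symm y).2, hee y⟩, fun x => ?_⟩
  change ((e.symm (S x) : P.domain) : H) = x
  rw [show S x = e x from rfl, e.symm_apply_apply]

theorem isResolventAt_resolventOf {P : H →ₗ.[ℂ] H} (hP : IsSelfAdjoint P) {z : ℂ}
    (hz : z.im ≠ 0) : IsResolventAt P z (resolventOf P z) := by
  have h := exists_isResolventAt hP hz
  rw [resolventOf, dif_pos h]
  exact h.choose_spec

theorem resolventOf_injective {P : H →ₗ.[ℂ] H} (hP : IsSelfAdjoint P) {z : ℂ}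
    (hz : z.im ≠ 0) : Function.Injective (resolventOf P z) := by
  obtain ⟨h, -⟩ := isResolventAt_resolventOf hP hz
  intro x y hxy
  obtain ⟨hx, hx'⟩ := h x
  obtain ⟨hy, hy'⟩ := h y
  rw [← hx', ← hy']
  simp only [hxy]

theorem adjoint_resolventOf {P : H →ₗ.[ℂ] H} (hP : IsSelfAdjoint P) {z : ℂ}
    (hz : z.im ≠ 0) :
    star (resolventOf P z) = resolventOf P (starRingEnd ℂ z) := by
  have hz' : (starRingEnd ℂ z).im ≠ 0 := by simpa using hz
  rw [ContinuousLinearMap.star_eq_adjoint, eq_comm, ContinuousLinearMap.eq_adjoint_iff]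
  intro x y
  obtain ⟨hx, hx'⟩ := (isResolventAt_resolventOf hP hz').1 x
  obtain ⟨hy, hy'⟩ := (isResolventAt_resolventOf hP hz).1 y
  have h := inner_symm hP ⟨_, hx⟩ ⟨_, hy⟩
  simp only at h
  conv_lhs => rw [← hy']
  conv_rhs => rw [← hx']
  rw [inner_sub_left, inner_sub_right, inner_smul_left, inner_smul_right, h, Complex.conj_conj]

theorem resolventOf_sub {P : H →ₗ.[ℂ] H} (hP : IsSelfAdjoint P) {z w : ℂ}
    (hz : z.im ≠ 0) (hw : w.im ≠ 0) :
    resolventOf P z - resolventOf P w = (z - w) • (resolventOf P z * resolventOf P w) := by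
  ext x
  obtain ⟨hx, hx'⟩ := (isResolventAt_resolventOf hP hw).1 x
  have h := (isResolventAt_resolventOf hP hz).2 ⟨_, hx⟩
  simp only at h
  have h2 : P ⟨_, hx⟩ - z • resolventOf P w x = x - (z - w) • resolventOf P w x := by
    nth_rewrite 3 [← hx']
    rw [sub_smul]; abel
  rw [h2, map_sub, map_smul] at h
  simp only [sub_apply, smul_apply, mul_apply_eq_comp]
  nth_rewrite 1 [← h]
  abel

theorem commute_resolventOf {P : H →ₗ.[ℂ] H} (hP : IsSelfAdjoint P) {z w : ℂ}
    (hz : z.im ≠ 0) (hw : w.im ≠ 0) :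
    Commute (resolventOf P z) (resolventOf P w) := by
  by_cases hzw : z = w
  · rw [hzw]
  · have h1 := resolventOf_sub hP hz hw
    have h2 := resolventOf_sub hP hw hz
    have h3 : (z - w) • (resolventOf P z * resolventOf P w) =
        (z - w) • (resolventOf P w * resolventOf P z) := by
      rw [← h1, ← neg_sub, h2, ← neg_smul, neg_sub]
    exact smul_right_injective _ (sub_ne_zero.mpr hzw) h3

theorem isStarNormal_resolventOf {P : H →ₗ.[ℂ] H} (hP : IsSelfAdjoint P) {z : ℂ}
    (hz : z.im ≠ 0) : IsStarNormal (resolventOf P z) :=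
  ⟨by
    rw [adjoint_resolventOf hP hz]
    exact commute_resolventOf hP (by simpa using hz) hz⟩

theorem spectrum_resolventOf_neg_I {P : H →ₗ.[ℂ] H} (hP : IsSelfAdjoint P) {μ : ℂ}
    (hμ : μ ∈ spectrum ℂ (resolventOf P (-Complex.I))) : 0 ≤ μ.re ∨ μ.im ≠ 0 := by
  by_contra hcon
  push Not at hcon
  obtain ⟨hre, him⟩ := hcon
  have hμ0 : μ ≠ 0 := fun h => by simp [h] at hre
  have hI : (-Complex.I).im ≠ 0 := by simp
  have hw : (μ⁻¹ - Complex.I).im ≠ 0 := by simp [Complex.inv_im, him]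
  refine hμ (?_ : IsUnit _)
  have h1 := resolventOf_sub hP hw hI
  have hc := commute_resolventOf hP hw hI
  set T := resolventOf P (-Complex.I)
  set R := resolventOf P (μ⁻¹ - Complex.I)
  have h2 : R - T = μ⁻¹ • (R * T) := by rw [h1]; congr 1; ring
  have h3 : (μ • (1 : H →L[ℂ] H) - T) * (μ⁻¹ • (1 + μ⁻¹ • R)) = 1 := by
    have h4 : (μ • (1 : H →L[ℂ] H) - T) * (1 + μ⁻¹ • R) = μ • 1 := by
      rw [sub_mul, mul_add, mul_add, mul_one, mul_one, smul_mul_assoc, one_mul, smul_smul,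
        mul_inv_cancel₀ hμ0, one_smul, mul_smul_comm, ← hc.eq, ← h2]
      abel
    rw [mul_smul_comm, h4, smul_smul, inv_mul_cancel₀ hμ0, one_smul]
  have hcomm : Commute (μ • (1 : H →L[ℂ] H) - T) (μ⁻¹ • (1 + μ⁻¹ • R)) := by
    refine Commute.smul_right (Commute.add_right (Commute.one_right _)
      (Commute.smul_right ?_ _)) _
    exact (((Commute.one_left R).smul_left μ).sub_left hc.symm)
  rw [Algebra.algebraMap_eq_smul_one]
  exact ⟨⟨_, _, h3, hcomm.eq ▸ h3⟩, rfl⟩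

/-- The bounded operator `(P + i)⁻ˢ`, `s ≥ 0`, for a self-adjoint `P`: the function `z ↦ zˢ`
(principal branch) of the bounded normal operator `(P + i)⁻¹`, by continuous functional calculus.
The spectrum of `(P + i)⁻¹` lies in `{0} ∪ {z | z.im < 0}`. -/
noncomputable def invPow (P : H →ₗ.[ℂ] H) (s : ℝ≥0) : H →L[ℂ] H :=
  cfc (fun z : ℂ => z ^ ((s : ℝ) : ℂ)) (resolventOf P (-Complex.I))

theorem invPow_injective {P : H →ₗ.[ℂ] H} (hP : IsSelfAdjoint P) (s : ℝ≥0) :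
    Function.Injective (invPow P s) := by
  have hI : (-Complex.I).im ≠ 0 := by simp
  have hN : IsStarNormal (resolventOf P (-Complex.I)) := isStarNormal_resolventOf hP hI
  rcases eq_or_ne s 0 with rfl | hs
  · have : invPow P 0 = 1 := by
      simp only [invPow, NNReal.coe_zero, Complex.ofReal_zero, Complex.cpow_zero]
      exact cfc_const_one ℂ _
    rw [this]
    exact fun _ _ h => h
  have hcont : ∀ r : ℝ, 0 < r → ContinuousOn (fun z : ℂ => z ^ (r : ℂ))
      (spectrum ℂ (resolventOf P (-Complex.I))) := fun r hr z hz =>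
    (Complex.continuousAt_cpow_const_of_re_pos (spectrum_resolventOf_neg_I hP hz)
      (by simpa using hr)).continuousWithinAt
  have hs' : (0 : ℝ) < s := by exact_mod_cast pos_iff_ne_zero.mpr hs
  obtain ⟨n, hn⟩ := exists_nat_gt (s : ℝ)
  have hprod : cfc (fun z : ℂ => z ^ (((n : ℝ) - s : ℝ) : ℂ)) (resolventOf P (-Complex.I)) *
      invPow P s = resolventOf P (-Complex.I) ^ n := by
    rw [invPow, ← cfc_mul _ _ _ (hcont _ (sub_pos.mpr hn)) (hcont _ hs'), ← cfc_pow_id (R := ℂ) (resolventOf P (-Complex.I)) n]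
    congr 1
    funext z
    rcases eq_or_ne z 0 with rfl | hz
    · have h1 : n ≠ 0 := by rintro rfl; simp at hn
      rw [Complex.zero_cpow (by exact_mod_cast (sub_pos.mpr hn).ne'), zero_mul, zero_pow h1]
    · rw [← Complex.cpow_add _ _ hz]
      push_cast
      rw [sub_add_cancel, Complex.cpow_natCast]
  have hinj : Function.Injective (resolventOf P (-Complex.I) ^ n : H →L[ℂ] H) := by
    rw [FunLike.coe_pow_eq_iterate]
    exact (resolventOf_injective hP hI).iterate n
  rw [← hprod] at hinj
  exact Function.Injective.of_comp hinj

/-- The space `𝒟ˢ = (P + i)⁻ˢ H`, the range of the operator `(P + i)⁻ˢ`. -/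
def DomPow (P : H →ₗ.[ℂ] H) (_hP : IsSelfAdjoint P) (s : ℝ≥0) : Type _ :=
  LinearMap.range (invPow P s : H →ₗ[ℂ] H)

namespace DomPow

variable {P : H →ₗ.[ℂ] H} {hP : IsSelfAdjoint P} {s : ℝ≥0}

noncomputable instance : AddCommGroup (DomPow P hP s) :=
  inferInstanceAs (AddCommGroup (LinearMap.range (invPow P s : H →ₗ[ℂ] H)))

noncomputable instance : Module ℂ (DomPow P hP s) :=
  inferInstanceAs (Module ℂ (LinearMap.range (invPow P s : H →ₗ[ℂ] H)))

/-- The isomorphism `(P + i)ˢ : 𝒟ˢ → H`. -/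
noncomputable def toPow (P : H →ₗ.[ℂ] H) (hP : IsSelfAdjoint P) (s : ℝ≥0) :
    DomPow P hP s ≃ₗ[ℂ] H :=
  (LinearEquiv.ofInjective (invPow P s : H →ₗ[ℂ] H) (invPow_injective hP s)).symm

/-- The norm of `𝒟ˢ` is `‖g‖ = ‖(P + i)ˢ g‖`. -/
noncomputable instance : NormedAddCommGroup (DomPow P hP s) :=
  NormedAddCommGroup.induced _ H (toPow P hP s) (toPow P hP s).injective

noncomputable instance : NormedSpace ℂ (DomPow P hP s) :=
  NormedSpace.induced ℂ _ H (toPow P hP s)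

instance : CoeOut (DomPow P hP s) H := ⟨Subtype.val⟩

theorem norm_def (g : DomPow P hP s) : ‖g‖ = ‖toPow P hP s g‖ := rfl

theorem coe_eq (g : DomPow P hP s) : (g : H) = invPow P s (toPow P hP s g) := by
  conv_lhs => rw [← (toPow P hP s).symm_apply_apply g]
  rfl

end DomPow

/-- `c₀ > 0`, and the family of bounded operators `F` is a holomorphic continuation of the cut-off
resolvent `χ R(z) χ`, `R(z) = (P - z²)⁻¹`, from `{Im z > 0, Re z ≠ 0}` to
`{Im z > -c₀, Re z ≠ 0}`. -/
structure IsCutoffResolventContinuation (P : H →ₗ.[ℂ] H) (χ : H →L[ℂ] H) (c₀ : ℝ)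
    (F : ℂ → H →L[ℂ] H) : Prop where
  pos : 0 < c₀
  holomorphic : DifferentiableOn ℂ F {z | -c₀ < z.im ∧ z.re ≠ 0}
  eq_cutoff : ∀ z : ℂ, 0 < z.im → z.re ≠ 0 → F z = χ ∘L resolventOf P (z ^ 2) ∘L χ

/-- The logarithm with argument in `(-π/2, 3π/2)`, holomorphic off `-i[0, ∞)`. -/
noncomputable def logDown (z : ℂ) : ℂ :=
  Complex.log (-Complex.I * z) + Complex.I * (Real.pi / 2)

/-- The logarithm with argument in `(-3π/2, π/2)`, holomorphic off `i[0, ∞)`. -/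
noncomputable def logUp (b : ℂ) : ℂ :=
  Complex.log (Complex.I * b) - Complex.I * (Real.pi / 2)

/-- The function `z^ν log^k(b z)` on `arg z ∈ (-π/2, 3π/2)`, where `log(b z) = log b + log z`. -/
noncomputable def powLog (ν : ℝ) (b : ℂ) (k : ℤ) (z : ℂ) : ℂ :=
  Complex.exp (ν * logDown z) * (logUp b + logDown z) ^ k

/-- The region `arg z ∈ (-π/2, 3π/2)`, `|Re z| < c₀`, `|Im z| < c₀`. -/
def slitSquare (c₀ : ℝ) : Set ℂ :=
  {z | -Complex.I * z ∈ Complex.slitPlane ∧ |z.re| < c₀ ∧ |z.im| < c₀}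

variable {P : H →ₗ.[ℂ] H} {hP : IsSelfAdjoint P} {p q : ℝ≥0}

/-- The expansion `F(z) = ∑_{j ∈ ℕ, k ∈ ℤ} B_{j,k} z^{ν_j} log^k(b_{j,k} z)` near `z = 0` of the
continued cut-off resolvent `F(z) = χ R(z) χ`, with bounded coefficients `B_{j,k} = χ A_{j,k} χ`
from `𝒟ᵖ` to `𝒟^q`; the series converges absolutely, and uniformly on compact subsets of the slit
square, in the operator norm of `𝒟ᵖ → 𝒟^q`. The sum is compared with `F` where `F` is given,
that is off the imaginary axis. -/
structure HasResolventExpansion (c₀ : ℝ) (F : ℂ → H →L[ℂ] H) (ν : ℕ → ℝ) (b : ℕ → ℤ → ℂ)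
    (B : ℕ → ℤ → DomPow P hP p →L[ℂ] DomPow P hP q) : Prop where
  off_ray : ∀ j k, ∀ y : ℝ, 0 ≤ y → b j k ≠ y * Complex.I
  expansion : ∃ G : ℂ → DomPow P hP p →L[ℂ] DomPow P hP q,
    (∀ z ∈ slitSquare c₀, z.re ≠ 0 → ∀ g : DomPow P hP p, (G z g : H) = F z (g : H)) ∧
    (∀ z ∈ slitSquare c₀,
      Summable fun jk : ℕ × ℤ => ‖powLog (ν jk.1) (b jk.1 jk.2) jk.2 z • B jk.1 jk.2‖) ∧
    ∀ K ⊆ slitSquare c₀, IsCompact K →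
      HasSumUniformlyOn
        (fun (jk : ℕ × ℤ) (z : ℂ) => powLog (ν jk.1) (b jk.1 jk.2) jk.2 z • B jk.1 jk.2) G K

/-- The integral of `g` over the contour `γ(δ, c)`, oriented from left to right around the slit
`-i[0, ∞)`: up the segment from `-δ - ic` to `-δ`, along the upper half of the circle `|z| = δ` from
`-δ` to `δ`, and down the segment from `δ` to `δ - ic`. -/
noncomputable def contourIntegral (δ c : ℝ) (g : ℂ → ℂ) : ℂ :=
  (∫ y in (-c)..0, g (-δ + y * Complex.I) * Complex.I) +
  (∫ θ in Real.pi..0, g (δ * Complex.exp (θ * Complex.I)) *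
    (δ * Complex.I * Complex.exp (θ * Complex.I))) +
  ∫ y in 0..(-c), g (δ + y * Complex.I) * Complex.I

/-- `v` is the sum of the zero-energy series
`(1/2π) ∑_{j,k} χ A_{j,k} χ f · lim_{δ → 0⁺} ∫_{γ(δ,c)} e^{-itz} z^{ν_j} log^k(b_{j,k} z) dz`,
convergent in `𝒟^q`: the limits exist for all terms that are present (`B_{j,k} ≠ 0`), and the series
converges to `v`. -/
def HasZeroEnergySum (c : ℝ) (ν : ℕ → ℝ) (b : ℕ → ℤ → ℂ)
    (B : ℕ → ℤ → DomPow P hP p →L[ℂ] DomPow P hP q) (f : DomPow P hP p) (t : ℝ)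
    (v : DomPow P hP q) : Prop :=
  ∃ ℓ : ℕ → ℤ → ℂ,
    (∀ j k, B j k ≠ 0 → Filter.Tendsto
      (fun δ : ℝ => contourIntegral δ c
        fun z => Complex.exp (-Complex.I * t * z) * powLog (ν j) (b j k) k z)
      (𝓝[>] 0) (𝓝 (ℓ j k))) ∧
    HasSum (fun jk : ℕ × ℤ => (1 / (2 * Real.pi) * ℓ jk.1 jk.2 : ℂ) • B jk.1 jk.2 f) v

/-- `u_z` is a zero-energy contribution for the initial velocity `f`: for `t ≥ 0`, its cut-off
`χ u_z(t)` is the sum of the zero-energy series. -/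
def IsZeroEnergyContribution (χ : H →L[ℂ] H) (c : ℝ) (ν : ℕ → ℝ) (b : ℕ → ℤ → ℂ)
    (B : ℕ → ℤ → DomPow P hP p →L[ℂ] DomPow P hP q) (f : DomPow P hP p) (u_z : ℝ → H) : Prop :=
  ∀ t : ℝ, 0 ≤ t → ∃ v : DomPow P hP q, (v : H) = χ (u_z t) ∧ HasZeroEnergySum c ν b B f t v

/-- The coefficient of `z^m log^0` in the expansion: the sum of all `B_{j,0}` with `ν_j = m`
(a single operator if the exponents are distinct, and `0` if `m` does not occur). -/
noncomputable def expCoeff (ν : ℕ → ℝ) (B : ℕ → ℤ → DomPow P hP p →L[ℂ] DomPow P hP q) (m : ℤ) :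
    DomPow P hP p →L[ℂ] DomPow P hP q :=
  ∑' j, Set.indicator {j | ν j = m} (fun j => B j 0) j

end WaveExpansion

/-!
Every term of the zero-energy series is a scalar contour integral of `e^{-itz} z^n` with an integer
`n ≥ -2`. On the plane slit along `-i[0, ∞)`, the Laurent expansion of `e^{-itz}` at `0` writes this
integrand as `a z⁻² + d z⁻¹ + E(z)` with `E` entire, where `d` is the residue: `d = 0` for `n ≥ 0`,
`d = 1` for `n = -1` and `d = -it` for `n = -2` (`exists_laurent`). It therefore has the primitive
`-a z⁻¹ + d log z + Φ(z)`, with `Φ` entire and the logarithm cut along `-i[0, ∞)`, and the contour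
integral is the difference of the values of the primitive at `δ - ic` and `-δ - ic`
(`contourIntegral_eq_sub`). As `δ → 0⁺` the two end points meet at `-ic`, so only the jump `-2πi` of
the logarithm across its cut survives (`tendsto_contourIntegral`), and the limit is `-2πi d`. After
division by `2π` the terms with `n = -2` contribute `-t B_{j,0} f`, those with `n = -1` contribute
`-i B_{j,0} f`, and all others vanish.

The coefficients of a fixed power `z^m` are absolutely summable because at the point `i c₀ / 2` of
the slit square the expansion converges absolutely and their scalar factor there is a common nonzero
number (`summable_indicator_coeff`); `𝒟^q` is complete, being isometric to `H`. The series is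
therefore the sum of the two operator series for `m = -2` and `m = -1` applied to `f`, and the value
of the zero-energy series is unique since limits and sums are.
-/

open Filter Set

namespace WaveExpansion

variable {H : Type*} [NormedAddCommGroup H] [InnerProductSpace ℂ H] [CompleteSpace H]
  {P : H →ₗ.[ℂ] H} {hP : IsSelfAdjoint P} {p q : ℝ≥0}

instance DomPow.instCompleteSpace {s : ℝ≥0} : CompleteSpace (DomPow P hP s) :=
  let e : DomPow P hP s ≃ₗᵢ[ℂ] H := ⟨DomPow.toPow P hP s, fun _ => rfl⟩
  (completeSpace_congr (e := e.toEquiv) e.isometry.isUniformEmbedding).mpr inferInstance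

/-! ### Integer powers and the contour -/

/-- The plane slit along `-i[0, ∞)`, that is `arg z ∈ (-π/2, 3π/2)`. -/
def downSlitPlane : Set ℂ := {z | -Complex.I * z ∈ Complex.slitPlane}

theorem ne_zero_of_mem_downSlitPlane {z : ℂ} (hz : z ∈ downSlitPlane) : z ≠ 0 := by
  rintro rfl
  simp [downSlitPlane] at hz

theorem exp_logDown {z : ℂ} (hz : z ≠ 0) : Complex.exp (logDown z) = z := by
  have hI : Complex.exp (Complex.I * (Real.pi / 2)) = Complex.I := by
    rw [mul_comm, Complex.exp_pi_div_two_mul_I]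
  rw [logDown, Complex.exp_add, Complex.exp_log (by simpa using hz), hI]
  linear_combination (-z) * Complex.I_mul_I

theorem powLog_intCast_zero (n : ℤ) (b : ℂ) {z : ℂ} (hz : z ≠ 0) :
    powLog n b 0 z = z ^ n := by
  rw [powLog, zpow_zero, mul_one]
  push_cast
  rw [Complex.exp_int_mul, exp_logDown hz]

theorem hasDerivAt_logDown {z : ℂ} (hz : z ∈ downSlitPlane) : HasDerivAt logDown z⁻¹ z := by
  have h0 := ne_zero_of_mem_downSlitPlane hz
  have h := (((hasDerivAt_id z).const_mul (-Complex.I)).clog hz).add_const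
    (Complex.I * (Real.pi / 2))
  refine h.congr_deriv ?_
  simp only [id_eq]
  field_simp

/-- The contour integral of a function with a primitive off the slit `-i[0, ∞)` is the difference
of the values of the primitive at the end points of the contour. -/
theorem contourIntegral_eq_sub {g Φ : ℂ → ℂ} (hΦ : ∀ z ∈ downSlitPlane, HasDerivAt Φ (g z) z)
    (hg : ContinuousOn g downSlitPlane) {δ : ℝ} (hδ : 0 < δ) (c : ℝ) :
    contourIntegral δ c g = Φ (δ + (-c : ℝ) * Complex.I) - Φ (-δ + (-c : ℝ) * Complex.I) := by
  have hline : ∀ a : ℝ, a ≠ 0 → ∀ y : ℝ, (a : ℂ) + y * Complex.I ∈ downSlitPlane := fun a ha y =>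
    Complex.mem_slitPlane_iff.mpr (Or.inr (by simpa using ha))
  have hvert : ∀ a : ℝ, a ≠ 0 → ∀ y₁ y₂ : ℝ,
      ∫ y in y₁..y₂, g (a + y * Complex.I) * Complex.I =
        Φ (a + y₂ * Complex.I) - Φ (a + y₁ * Complex.I) := by
    intro a ha y₁ y₂
    refine intervalIntegral.integral_eq_sub_of_hasDerivAt
      (f := fun y : ℝ => Φ (a + y * Complex.I)) (fun y _ => ?_) ?_
    · have h : HasDerivAt (fun y : ℝ => (a : ℂ) + y * Complex.I) Complex.I y := by
        simpa using ((Complex.ofRealCLM.hasDerivAt (x := y)).mul_const Complex.I).const_add (a : ℂ)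
      exact (hΦ _ (hline a ha y)).comp y h
    · refine (Continuous.mul ?_ continuous_const).intervalIntegrable _ _
      exact hg.comp_continuous (by fun_prop) (hline a ha)
  have harc : ∀ θ ∈ uIcc Real.pi 0, (δ : ℂ) * Complex.exp (θ * Complex.I) ∈ downSlitPlane := by
    intro θ hθ
    rw [uIcc_of_ge Real.pi_pos.le] at hθ
    refine Complex.mem_slitPlane_iff.mpr ?_
    have hre : (-Complex.I * (δ * Complex.exp (θ * Complex.I))).re = δ * Real.sin θ := by
      simp [Complex.exp_ofReal_mul_I_im]
    have him : (-Complex.I * (δ * Complex.exp (θ * Complex.I))).im = -(δ * Real.cos θ) := by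
      simp [Complex.exp_ofReal_mul_I_re]
    rw [hre, him]
    rcases (Real.sin_nonneg_of_mem_Icc hθ).eq_or_lt with h | h
    · right
      have hcos : Real.cos θ ≠ 0 := fun h' => by
        have := Real.sin_sq_add_cos_sq θ
        rw [← h, h'] at this
        norm_num at this
      exact neg_ne_zero.mpr (mul_ne_zero hδ.ne' hcos)
    · exact Or.inl (mul_pos hδ h)
  have hcirc : (∫ θ in Real.pi..0, g (δ * Complex.exp (θ * Complex.I)) *
      (δ * Complex.I * Complex.exp (θ * Complex.I))) = Φ δ - Φ (-δ) := by
    have h := intervalIntegral.integral_eq_sub_of_hasDerivAt (a := Real.pi) (b := 0)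
      (f := fun θ : ℝ => Φ (δ * Complex.exp (θ * Complex.I)))
      (f' := fun θ : ℝ => g (δ * Complex.exp (θ * Complex.I)) *
        (δ * Complex.I * Complex.exp (θ * Complex.I))) (fun θ hθ => ?_) ?_
    · simpa [Complex.exp_pi_mul_I] using h
    · have h : HasDerivAt (fun θ : ℝ => (δ : ℂ) * Complex.exp (θ * Complex.I))
          (δ * Complex.I * Complex.exp (θ * Complex.I)) θ := by
        have h1 : HasDerivAt (fun θ : ℝ => (θ : ℂ) * Complex.I) Complex.I θ := by
          simpa using (Complex.ofRealCLM.hasDerivAt (x := θ)).mul_const Complex.I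
        exact (h1.cexp.const_mul (δ : ℂ)).congr_deriv (by ring)
      exact (hΦ _ (harc θ hθ)).comp θ h
    · refine (ContinuousOn.mul (hg.comp (by fun_prop) harc) ?_).intervalIntegrable
      fun_prop
  have hl := hvert (-δ) (neg_ne_zero.mpr hδ.ne') (-c) 0
  have hr := hvert δ hδ.ne' 0 (-c)
  simp only [Complex.ofReal_zero, zero_mul, add_zero, Complex.ofReal_neg] at hl hr
  rw [contourIntegral, hl, hr, hcirc]
  push_cast
  ring

/-! ### The limit of the contour integrals -/

theorem tendsto_logDown_right {c : ℝ} (hc : 0 < c) :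
    Tendsto (fun δ : ℝ => logDown (δ + (-c : ℝ) * Complex.I)) (𝓝[>] 0)
      (𝓝 (Real.log c - Real.pi * Complex.I + Complex.I * (Real.pi / 2))) := by
  have h := Complex.tendsto_log_nhdsWithin_im_neg_of_re_neg_of_im_zero (z := -(c : ℂ))
    (by simpa using hc) (by simp)
  rw [norm_neg, Complex.norm_of_nonneg hc.le] at h
  refine Tendsto.add_const _ (h.comp (tendsto_nhdsWithin_iff.mpr ⟨?_, ?_⟩))
  · refine Tendsto.mono_left (Continuous.tendsto' (by fun_prop) _ _ ?_) nhdsWithin_le_nhds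
    push_cast
    linear_combination (c : ℂ) * Complex.I_mul_I
  · filter_upwards [self_mem_nhdsWithin] with δ hδ
    simpa using hδ

theorem tendsto_logDown_left {c : ℝ} (hc : 0 < c) :
    Tendsto (fun δ : ℝ => logDown (-δ + (-c : ℝ) * Complex.I)) (𝓝[>] 0)
      (𝓝 (Real.log c + Real.pi * Complex.I + Complex.I * (Real.pi / 2))) := by
  have h := Complex.tendsto_log_nhdsWithin_im_nonneg_of_re_neg_of_im_zero (z := -(c : ℂ))
    (by simpa using hc) (by simp)
  rw [norm_neg, Complex.norm_of_nonneg hc.le] at h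
  refine Tendsto.add_const _ (h.comp (tendsto_nhdsWithin_iff.mpr ⟨?_, ?_⟩))
  · refine Tendsto.mono_left (Continuous.tendsto' (by fun_prop) _ _ ?_) nhdsWithin_le_nhds
    push_cast
    linear_combination (c : ℂ) * Complex.I_mul_I
  · filter_upwards [self_mem_nhdsWithin] with δ hδ
    simpa using (mem_Ioi.mp hδ).le

/-- The residue theorem for the contour: as the end points meet at `-ic`, the primitives of `z⁻²`
and of `E` cancel and the logarithm jumps by `-2πi`. -/
theorem tendsto_contourIntegral {g E : ℂ → ℂ} {a d : ℂ} (hE : Differentiable ℂ E)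
    (hg : ∀ z ∈ downSlitPlane, g z = a * (z ^ 2)⁻¹ + d * z⁻¹ + E z) {c : ℝ} (hc : 0 < c) :
    Tendsto (fun δ : ℝ => contourIntegral δ c g) (𝓝[>] 0)
      (𝓝 (-(2 * Real.pi * Complex.I) * d)) := by
  obtain ⟨Ψ, hΨ⟩ := hE.isExactOn_univ
  have hΨ' : ∀ z, HasDerivAt Ψ (E z) z := fun z => hΨ z (mem_univ z)
  have hΨc : Continuous Ψ := continuous_iff_continuousAt.mpr fun z => (hΨ' z).continuousAt
  have hgc : ContinuousOn g downSlitPlane := by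
    refine ContinuousOn.congr ?_ hg
    have hE' := hE.continuous.continuousOn (s := downSlitPlane)
    refine ContinuousOn.add (ContinuousOn.add (continuousOn_const.mul ?_)
      (continuousOn_const.mul ?_)) hE'
    · exact (continuousOn_id.pow 2).inv₀ fun z hz => pow_ne_zero 2 (ne_zero_of_mem_downSlitPlane hz)
    · exact continuousOn_id.inv₀ fun z hz => ne_zero_of_mem_downSlitPlane hz
  have hderiv : ∀ z ∈ downSlitPlane,
      HasDerivAt (fun z => (-a * z⁻¹ + Ψ z) + d * logDown z) (g z) z := by
    intro z hz
    have h := (((hasDerivAt_inv (ne_zero_of_mem_downSlitPlane hz)).const_mul (-a)).add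
      (hΨ' z)).add ((hasDerivAt_logDown hz).const_mul d)
    refine h.congr_deriv ?_
    rw [hg z hz]
    ring
  have hc0 : ((-c : ℝ) : ℂ) * Complex.I ≠ 0 := by simp [hc.ne']
  have hcont : ContinuousAt (fun z => -a * z⁻¹ + Ψ z) (((-c : ℝ) : ℂ) * Complex.I) :=
    (continuousAt_const.mul (continuousAt_inv₀ hc0)).add hΨc.continuousAt
  have hpr : Tendsto (fun δ : ℝ => (δ : ℂ) + (-c : ℝ) * Complex.I) (𝓝[>] 0)
      (𝓝 (((-c : ℝ) : ℂ) * Complex.I)) :=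
    Tendsto.mono_left (Continuous.tendsto' (by fun_prop) _ _ (by simp)) nhdsWithin_le_nhds
  have hpl : Tendsto (fun δ : ℝ => -(δ : ℂ) + (-c : ℝ) * Complex.I) (𝓝[>] 0)
      (𝓝 (((-c : ℝ) : ℂ) * Complex.I)) :=
    Tendsto.mono_left (Continuous.tendsto' (by fun_prop) _ _ (by simp)) nhdsWithin_le_nhds
  have hlim := ((hcont.tendsto.comp hpr).add ((tendsto_logDown_right hc).const_mul d)).sub
    ((hcont.tendsto.comp hpl).add ((tendsto_logDown_left hc).const_mul d))
  have hval : ∀ x y : ℂ, x + d * (Real.log c - Real.pi * Complex.I + y) -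
      (x + d * (Real.log c + Real.pi * Complex.I + y)) = -(2 * Real.pi * Complex.I) * d :=
    fun x y => by ring
  rw [hval] at hlim
  refine hlim.congr' ?_
  filter_upwards [self_mem_nhdsWithin] with δ hδ
  exact (contourIntegral_eq_sub hderiv hgc hδ c).symm

/-- The residue at `0` of `e^{-itz} zⁿ`, for `n ≥ -2`. -/
noncomputable def expResidue (t : ℝ) (n : ℤ) : ℂ :=
  if n = -2 then -Complex.I * t else if n = -1 then 1 else 0

/-- Splitting off the principal part: for `n < 0` the remainder is an iterated `dslope` of the
exponential, hence entire. -/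
theorem exists_laurent (t : ℝ) {n : ℤ} (hn : -2 ≤ n) :
    ∃ (a : ℂ) (E : ℂ → ℂ), Differentiable ℂ E ∧ ∀ z : ℂ, z ≠ 0 →
      Complex.exp (-Complex.I * t * z) * z ^ n =
        a * (z ^ 2)⁻¹ + expResidue t n * z⁻¹ + E z := by
  set e : ℂ → ℂ := fun z => Complex.exp (-Complex.I * t * z) with he
  have hd : Differentiable ℂ e := by fun_prop
  have hdslope : ∀ {h : ℂ → ℂ}, Differentiable ℂ h → Differentiable ℂ (dslope h 0) := fun hh =>
    differentiableOn_univ.mp ((Complex.differentiableOn_dslope univ_mem).mpr hh.differentiableOn)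
  have hderiv : deriv e 0 = -Complex.I * t := by
    have h : HasDerivAt e _ 0 := ((hasDerivAt_id (0 : ℂ)).const_mul (-Complex.I * t)).cexp
    rw [h.deriv]
    simp
  have h1 : ∀ z, e z = 1 + z * dslope e 0 z := fun z => by
    have h := sub_smul_dslope e 0 z
    rw [sub_zero, smul_eq_mul] at h
    rw [h, he]
    simp
  have h2 : ∀ z, dslope e 0 z = -Complex.I * t + z * dslope (dslope e 0) 0 z := fun z => by
    have h := sub_smul_dslope (dslope e 0) 0 z
    rw [sub_zero, smul_eq_mul, dslope_same, hderiv] at h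
    rw [h]
    ring
  obtain rfl | rfl | h0 : n = -2 ∨ n = -1 ∨ 0 ≤ n := by omega
  · refine ⟨1, dslope (dslope e 0) 0, hdslope (hdslope hd), fun z hz => ?_⟩
    have h := h1 z
    rw [h2 z] at h
    have hz2 : z ^ (-2 : ℤ) = (z ^ 2)⁻¹ := by rw [zpow_neg]; rfl
    change e z * _ = _
    rw [h, hz2, expResidue, if_pos rfl]
    field_simp
    ring
  · refine ⟨0, dslope e 0, hdslope hd, fun z hz => ?_⟩
    change e z * _ = _
    rw [h1 z, zpow_neg_one, expResidue, if_neg (by norm_num), if_pos rfl]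
    field_simp
    ring
  · lift n to ℕ using h0
    refine ⟨0, fun z => e z * z ^ n, by fun_prop, fun z _ => ?_⟩
    rw [expResidue, if_neg (by omega), if_neg (by omega), zpow_natCast]
    simp [he]

theorem tendsto_contourIntegral_exp_mul_powLog {c : ℝ} (hc : 0 < c) (t : ℝ) (b : ℂ) {n : ℤ}
    (hn : -2 ≤ n) :
    Tendsto (fun δ : ℝ => contourIntegral δ c
        fun z => Complex.exp (-Complex.I * t * z) * powLog n b 0 z)
      (𝓝[>] 0) (𝓝 (-(2 * Real.pi * Complex.I) * expResidue t n)) := by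
  obtain ⟨a, E, hE, h⟩ := exists_laurent t hn
  refine tendsto_contourIntegral (a := a) hE (fun z hz => ?_) hc
  have h0 := ne_zero_of_mem_downSlitPlane hz
  rw [powLog_intCast_zero n b h0, h z h0]

/-! ### Summation of the series -/

/-- The coefficients of a fixed integer power are summable, by absolute convergence of the
expansion at the single point `i c₀ / 2`. -/
theorem summable_indicator_coeff {c₀ : ℝ} (hc₀ : 0 < c₀) {F : ℂ → H →L[ℂ] H} {ν : ℕ → ℝ}
    {b : ℕ → ℤ → ℂ} {B : ℕ → ℤ → DomPow P hP p →L[ℂ] DomPow P hP q}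
    (hB : HasResolventExpansion c₀ F ν b B) (m : ℤ) :
    Summable fun j => indicator {j | ν j = m} (fun j => B j 0) j := by
  obtain ⟨-, -, hsum, -⟩ := hB.expansion
  set z₀ : ℂ := Complex.I * (c₀ / 2 : ℝ) with hz₀
  have hz₀0 : z₀ ≠ 0 := mul_ne_zero Complex.I_ne_zero (by exact_mod_cast (half_pos hc₀).ne')
  have hmem : z₀ ∈ slitSquare c₀ := by
    refine ⟨Or.inl ?_, ?_, ?_⟩
    · simp [hz₀, hc₀]
    · simpa [hz₀] using hc₀
    · simpa [hz₀, abs_of_pos (half_pos hc₀)] using half_lt_self hc₀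
  have h := (hsum z₀ hmem).comp_injective (i := fun j : ℕ => (j, (0 : ℤ)))
    (Prod.mk_left_injective 0)
  refine Summable.of_norm_bounded (h.mul_left ‖z₀ ^ m‖⁻¹) fun j => ?_
  by_cases hj : ν j = m
  · rw [indicator_of_mem (by exact hj)]
    simp only [Function.comp_apply, hj]
    rw [powLog_intCast_zero m _ hz₀0, norm_smul,
      inv_mul_cancel_left₀ (norm_ne_zero_iff.mpr (zpow_ne_zero m hz₀0))]
  · rw [indicator_of_notMem (by exact hj), norm_zero]
    exact mul_nonneg (inv_nonneg.mpr (norm_nonneg _)) (norm_nonneg _)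

theorem HasZeroEnergySum.unique {c : ℝ} {ν : ℕ → ℝ} {b : ℕ → ℤ → ℂ}
    {B : ℕ → ℤ → DomPow P hP p →L[ℂ] DomPow P hP q} {f : DomPow P hP p} {t : ℝ}
    {v w : DomPow P hP q} (hv : HasZeroEnergySum c ν b B f t v)
    (hw : HasZeroEnergySum c ν b B f t w) : v = w := by
  obtain ⟨ℓ, hℓ, hsum⟩ := hv
  obtain ⟨ℓ', hℓ', hsum'⟩ := hw
  refine hsum.unique (hsum'.congr_fun fun jk => ?_)
  by_cases h : B jk.1 jk.2 = 0
  · simp [h]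
  · rw [tendsto_nhds_unique (hℓ _ _ h) (hℓ' _ _ h)]

theorem hasZeroEnergySum {c : ℝ} (hc : 0 < c) {ν : ℕ → ℝ} (b : ℕ → ℤ → ℂ)
    {B : ℕ → ℤ → DomPow P hP p →L[ℂ] DomPow P hP q}
    (hν : ∀ j, ∃ n : ℤ, -2 ≤ n ∧ ν j = n) (hlog : ∀ j k, k ≠ 0 → B j k = 0)
    (hsum : ∀ m : ℤ, Summable fun j => indicator {j | ν j = m} (fun j => B j 0) j)
    (f : DomPow P hP p) (t : ℝ) :
    HasZeroEnergySum c ν b B f t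
      (-(t : ℂ) • expCoeff ν B (-2) f - Complex.I • expCoeff ν B (-1) f) := by
  choose n hn hνn using hν
  refine ⟨fun j _ => -(2 * Real.pi * Complex.I) * expResidue t (n j), fun j k hjk => ?_, ?_⟩
  · obtain rfl : k = 0 := by_contra fun hk => hjk (hlog j k hk)
    rw [hνn j]
    exact tendsto_contourIntegral_exp_mul_powLog hc t (b j 0) (hn j)
  -- Only the pairs `(j, 0)` carry nonzero terms, so the double series is a series over `j`.
  refine (Function.Injective.hasSum_iff (g := fun j : ℕ => (j, (0 : ℤ)))
    (Prod.mk_left_injective 0) fun jk hjk => ?_).mp ?_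
  · have hk : jk.2 ≠ 0 := fun h => hjk ⟨jk.1, Prod.ext rfl h.symm⟩
    simp [hlog _ _ hk]
  have happ : ∀ m : ℤ, HasSum (fun j => indicator {j | ν j = m} (fun j => B j 0) j f)
      (expCoeff ν B m f) := fun m =>
    (ContinuousLinearMap.apply ℂ (DomPow P hP q) f).hasSum (hsum m).hasSum
  refine (((happ (-2)).const_smul (-(t : ℂ))).sub
    ((happ (-1)).const_smul Complex.I)).congr_fun fun j => ?_
  have hpi : (Real.pi : ℂ) ≠ 0 := by exact_mod_cast Real.pi_ne_zero
  have hscal : (1 / (2 * Real.pi) * (-(2 * Real.pi * Complex.I) * expResidue t (n j)) : ℂ) =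
      -Complex.I * expResidue t (n j) := by
    field_simp
  have hind : ∀ m : ℤ, indicator {j | ν j = m} (fun j => B j 0) j f =
      if n j = m then B j 0 f else 0 := fun m => by
    simp only [indicator_apply, mem_ofPred_eq, hνn j, Int.cast_inj]
    split_ifs <;> rfl
  simp only [Function.comp_apply]
  rw [hscal, hind, hind, expResidue]
  by_cases h2 : n j = -2
  · have hI : -Complex.I * (-Complex.I * t) = -(t : ℂ) := by
      linear_combination (t : ℂ) * Complex.I_mul_I
    rw [if_pos h2, hI, if_pos h2, if_neg (by omega), smul_zero, sub_zero]
  · by_cases h1 : n j = -1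
    · simp [h1]
    · simp [h1, h2]

end WaveExpansion

open WaveExpansion in
theorem corollary2p2 {H : Type*} [NormedAddCommGroup H] [InnerProductSpace ℂ H] [CompleteSpace H]
    (P : H →ₗ.[ℂ] H) (hP : IsSelfAdjoint P) (χ : H →L[ℂ] H) (c₀ : ℝ) (p q : ℝ≥0)
    (F : ℂ → H →L[ℂ] H) (hF : IsCutoffResolventContinuation P χ c₀ F)
    (ν : ℕ → ℝ) (b : ℕ → ℤ → ℂ) (B : ℕ → ℤ → DomPow P hP p →L[ℂ] DomPow P hP q)
    (hB : HasResolventExpansion c₀ F ν b B)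
    (hν : ∀ j, ∃ n : ℤ, -2 ≤ n ∧ ν j = n)
    (hlog : ∀ j k, k ≠ 0 → B j k = 0)
    (c : ℝ) (hc : 0 < c) (hc₀ : c < c₀)
    (f : DomPow P hP p) (hf : χ (f : H) = f) :
    (∀ m : ℤ, Summable fun j => Set.indicator {j | ν j = m} (fun j => B j 0) j) ∧
    (∀ t : ℝ, 0 ≤ t → HasZeroEnergySum c ν b B f t
      (-(t : ℂ) • expCoeff ν B (-2) f - Complex.I • expCoeff ν B (-1) f)) ∧
    ∀ u_z : ℝ → H, IsZeroEnergyContribution χ c ν b B f u_z → ∀ t : ℝ, 0 ≤ t →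
      χ (u_z t) =
        ((-(t : ℂ) • expCoeff ν B (-2) f - Complex.I • expCoeff ν B (-1) f : DomPow P hP q) : H)
    := by
  have hsum := summable_indicator_coeff hF.pos hB
  have hzero := hasZeroEnergySum hc b hν hlog hsum f
  refine ⟨hsum, fun t _ => hzero t, fun u_z hu t ht => ?_⟩
  obtain ⟨v, hv, hvsum⟩ := hu t ht
  rw [← hv, hvsum.unique (hzero t)]
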